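/- Let $X$ be a complex Banach space and let $\mathcal B(X)$ be the algebra of bounded linear operators on $X$. For $A\in\mathcal B(X)$ let $\mathcal N(A)$ and $\mathcal R(A)$ denote its null space and range, and put $$\Delta(A)=\{k\in\mathbb N_0:\ \mathcal N(A)\cap\mathcal R(A^k)=\mathcal N(A)\cap\mathcal R(A^m)\text{ for all } m\ge k\},\qquad \operatorname{dis}(A)=\inf\Delta(A),$$ with $\operatorname{dis}(A)=\infty$ if $\Delta(A)=\emptyset$. The operator $A$ is called - left B-Fredholm if $d=\operatorname{dis}(A)$ is finite, $\mathcal N(A)\cap\mathcal R(A^d)$ is finite-dimensional and $\mathcal R(A)+\mathcal N(A^d)$ is topologically complemented in $X$; - right B-Fredholm if $d=\operatorname{dis}(A)$ is finite, $\mathcal R(A)+\mathcal N(A^d)$ is closed of finite codimension in $X$ and $\mathcal N(A)\cap\mathcal R(A^d)$ is topologically complemented in $X$; - B-Fredholm if there is an integer $k\ge 0$ such that $\mathcal R(A^k)$ is closed and the restriction $A|_{\mathcal R(A^k)}:\mathcal R(A^k)\to\mathcal R(A^k)$ is a Fredholm operator. Let $\sigma_{LBF}(A)$, $\sigma_{RBF}(A)$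 and $\sigma_{BF}(A)$ be the sets of all $\lambda\in\mathbb C$ such that $\lambda I-A$ is not left B-Fredholm, not right B-Fredholm and not B-Fredholm, respectively. Let $T,S\in\mathcal B(X)$ satisfy $ST^n=T^{n+1}$ and $TS^n=S^{n+1}$ for some integer $n\ge 0$. Then $$\sigma_{*}(T)\setminus\{0\}=\sigma_{*}(S)\setminus\{0\}\qquad\text{for each } *\in\{LBF,\,RBF,\,BF\}.$$ -/

import Mathlib

namespace BFredholm

variable {X : Type*} [NormedAddCommGroup X] [NormedSpace ℂ X]

/-- The set `Δ(T)` of all `n` such that `N(T) ∩ R(Tⁿ) = N(T) ∩ R(Tᵐ)` for every `m ≥ n`. -/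
def stableSet (T : X →L[ℂ] X) : Set ℕ :=
  {n : ℕ | ∀ m : ℕ, n ≤ m → T.ker ⊓ (T ^ n).range = T.ker ⊓ (T ^ m).range}

/-- The degree of stable iteration `dis(T) = inf Δ(T)`, equal to `∞` if `Δ(T)` is empty. -/
noncomputable def dis (T : X →L[ℂ] X) : ℕ∞ :=
  ⨅ n ∈ stableSet T, (n : ℕ∞)

/-- `T` is left B-Fredholm: `d = dis(T)` is finite, `N(T) ∩ R(T^d)` is finite-dimensional and
`R(T) + N(T^d)` is topologically complemented in `X`. -/
def IsLeftBFredholm (T : X →L[ℂ] X) : Prop :=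
  ∃ d : ℕ, dis T = d ∧
    FiniteDimensional ℂ ↥(T.ker ⊓ (T ^ d).range) ∧
    (T.range ⊔ (T ^ d).ker).ClosedComplemented

/-- `T` is right B-Fredholm: `d = dis(T)` is finite, `R(T) + N(T^d)` is closed of finite
codimension and `N(T) ∩ R(T^d)` is topologically complemented in `X`. -/
def IsRightBFredholm (T : X →L[ℂ] X) : Prop :=
  ∃ d : ℕ, dis T = d ∧
    IsClosed ((T.range ⊔ (T ^ d).ker : Submodule ℂ X) : Set X) ∧
    FiniteDimensional ℂ (X ⧸ (T.range ⊔ (T ^ d).ker)) ∧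
    (T.ker ⊓ (T ^ d).range).ClosedComplemented

theorem mapsTo_range_pow (T : X →L[ℂ] X) (n : ℕ) :
    Set.MapsTo T ((T ^ n).range : Set X) ((T ^ n).range : Set X) := by
  rintro _ ⟨x, rfl⟩
  exact ⟨T x, congrArg (fun A : X →L[ℂ] X => A x) (Commute.pow_self T n).eq⟩

/-- The restriction of `T` to `R(Tⁿ)`, as an operator from `R(Tⁿ)` to itself. -/
def restrictRangePow (T : X →L[ℂ] X) (n : ℕ) : (T ^ n).range →L[ℂ] (T ^ n).range :=
  T.restrict (mapsTo_range_pow T n)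

/-- `T` is B-Fredholm: for some `n`, `R(Tⁿ)` is closed and `T` restricted to `R(Tⁿ)` is
Fredholm. -/
def IsBFredholm (T : X →L[ℂ] X) : Prop :=
  ∃ n : ℕ, IsClosed ((T ^ n).range : Set X) ∧ (restrictRangePow T n).IsFredholm

/-- The left B-Fredholm spectrum. -/
def leftBFredholmSpectrum (T : X →L[ℂ] X) : Set ℂ :=
  {z : ℂ | ¬ IsLeftBFredholm (z • (1 : X →L[ℂ] X) - T)}

/-- The right B-Fredholm spectrum. -/
def rightBFredholmSpectrum (T : X →L[ℂ] X) : Set ℂ :=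
  {z : ℂ | ¬ IsRightBFredholm (z • (1 : X →L[ℂ] X) - T)}

/-- The B-Fredholm spectrum. -/
def bFredholmSpectrum (T : X →L[ℂ] X) : Set ℂ :=
  {z : ℂ | ¬ IsBFredholm (z • (1 : X →L[ℂ] X) - T)}

end BFredholm

namespace BFredholm

/-! The hypotheses say that `T ^ n` intertwines `z - T` with `z - S`, and `S ^ n` does so in
reverse. Moreover `T ^ n * S ^ n = S ^ (n + n)`, and for `z ≠ 0` Bézout makes a power of `S`
invertible modulo `(z - S) ^ k`, with cofactors polynomial in `S`. So the two intertwiners are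
mutually inverse up to a multiple of `(z - S) ^ k`. On kernels the error vanishes, so the spaces `N
∩ R` of both operators coincide, and with them `dis`. On ranges the error is absorbed, so
closedness, finite codimension and complements transfer; Fredholmness transfers through a
parametrix. -/

section Retract

variable {X : Type*} [NormedAddCommGroup X] [NormedSpace ℂ X] {M N : Submodule ℂ X}
  {s t : X →L[ℂ] X}

/-- If `t ∘ s` is the identity modulo `N`, then `N` is the preimage of `M` under `s`. -/
theorem comap_eq_of_retract (ht : ∀ x ∈ M, t x ∈ N) (hs : ∀ x ∈ N, s x ∈ M)
    (hts : ∀ x, x - t (s x) ∈ N) : M.comap s.toLinearMap = N := by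
  ext x
  refine ⟨fun hx => ?_, hs x⟩
  simpa using N.add_mem (hts x) (ht _ hx)

theorem isClosed_of_retract (ht : ∀ x ∈ M, t x ∈ N) (hs : ∀ x ∈ N, s x ∈ M)
    (hts : ∀ x, x - t (s x) ∈ N) (hM : IsClosed (M : Set X)) : IsClosed (N : Set X) := by
  rw [← comap_eq_of_retract ht hs hts]
  exact hM.preimage s.continuous

/-- As `N` is the full preimage of `M`, `s` induces an injection `X ⧸ N → X ⧸ M`. -/
theorem finiteDimensional_quotient_of_retract (ht : ∀ x ∈ M, t x ∈ N) (hs : ∀ x ∈ N, s x ∈ M)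
    (hts : ∀ x, x - t (s x) ∈ N) (hM : FiniteDimensional ℂ (X ⧸ M)) :
    FiniteDimensional ℂ (X ⧸ N) := by
  refine FiniteDimensional.of_injective (N.mapQ M s.toLinearMap hs) ?_
  rw [← LinearMap.ker_eq_bot, Submodule.mapQ, Submodule.ker_liftQ, LinearMap.ker_comp,
    Submodule.ker_mkQ, comap_eq_of_retract ht hs hts, Submodule.mkQ_map_self]

theorem closedComplemented_of_retract (ht : ∀ x ∈ M, t x ∈ N) (hs : ∀ x ∈ N, s x ∈ M)
    (hts : ∀ x, x - t (s x) ∈ N) (hM : M.ClosedComplemented) : N.ClosedComplemented := by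
  obtain ⟨f, hf⟩ := hM
  -- Both `x - t (s x)` and `t (f (s x))` lie in `N`, and they add up to `x` when `x ∈ N`, since `f`
  -- then fixes `s x`.
  let g : X →L[ℂ] X := 1 - t * (1 - M.subtypeL ∘L f) * s
  have hg : ∀ x, g x = (x - t (s x)) + t (f (s x)) := fun x => by
    simp [g, sub_add]
  refine ⟨g.codRestrict N fun x => ?_, fun x => Subtype.ext ?_⟩
  · rw [hg]
    exact N.add_mem (hts x) (ht _ (f (s x)).2)
  · have h : f (s x) = ⟨s x, hs x x.2⟩ := hf ⟨s x, hs x x.2⟩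
    simp [hg, h]

end Retract

/-- A Fredholm operator `a` transfers along intertwining maps `s`, `t` to an operator `b` as soon
as `t ∘ s` is invertible modulo `b`. -/
theorem isFredholm_of_intertwining {E F : Type*} [NormedAddCommGroup E] [NormedSpace ℂ E]
    [NormedAddCommGroup F] [NormedSpace ℂ F] {a : E →L[ℂ] E} {b q : F →L[ℂ] F}
    {t : E →L[ℂ] F} {s : F →L[ℂ] E} (ht : t ∘L a = b ∘L t) (hs : s ∘L b = a ∘L s)
    (hqb : Commute q b) (h : t ∘L s + q * b = 1) (ha : a.IsFredholm) : b.IsFredholm := by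
  obtain ⟨v, hva, hav⟩ := ha.exists_isQuasiInverse
  have hts (x : F) : t (s x) = x - q (b x) := by
    exact eq_sub_of_add_eq (congrArg (fun f : F →L[ℂ] F => f x) h)
  have ht' (x : E) : t (a x) = b (t x) := congrArg (fun f : E →L[ℂ] F => f x) ht
  have hs' (x : F) : s (b x) = a (s x) := congrArg (fun f : F →L[ℂ] E => f x) hs
  have hq' (x : F) : q (b x) = b (q x) := congrArg (fun f : F →L[ℂ] F => f x) hqb.eq
  -- Modulo finite rank, `b (t v s + q) = t a v s + b q` is `t s + q b = 1`; likewise on the other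
  -- side.
  refine ContinuousLinearMap.IsFredholm.of_isQuasiInverse (v := t ∘L v ∘L s + q) ⟨?_, ?_⟩
  · have := LinearMap.FiniteRangeSetoid.equiv_iff_hasNoetherianRange.1 hva
    have key : (t ∘L v ∘L s + q).toLinearMap ∘ₗ b.toLinearMap - .id =
        t.toLinearMap ∘ₗ (v.toLinearMap ∘ₗ a.toLinearMap - .id) ∘ₗ s.toLinearMap := by
      refine LinearMap.ext fun x => ?_
      simp [hs', hts]
      abel
    refine LinearMap.FiniteRangeSetoid.equiv_iff_hasNoetherianRange.2 ?_
    rw [key]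
    exact (this.comp_right s.toLinearMap).comp_left t.toLinearMap
  · have := LinearMap.FiniteRangeSetoid.equiv_iff_hasNoetherianRange.1 hav
    have key : b.toLinearMap ∘ₗ (t ∘L v ∘L s + q).toLinearMap - .id =
        t.toLinearMap ∘ₗ (a.toLinearMap ∘ₗ v.toLinearMap - .id) ∘ₗ s.toLinearMap := by
      refine LinearMap.ext fun x => ?_
      simp [ht', hts, hq']
      abel
    refine LinearMap.FiniteRangeSetoid.equiv_iff_hasNoetherianRange.2 ?_
    rw [key]
    exact (this.comp_right s.toLinearMap).comp_left t.toLinearMap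

/-- For `z ≠ 0`, the elements `a ^ m` and `(z - a) ^ k` satisfy a Bézout identity whose cofactors
commute with `a`. -/
theorem exists_bezout_pow {R : Type*} [Ring R] [Algebra ℂ R] (a : R) {z : ℂ} (hz : z ≠ 0)
    (m k : ℕ) : ∃ p q : R, Commute p a ∧ Commute q a ∧
      p * a ^ m + q * (z • (1 : R) - a) ^ k = 1 := by
  have h : IsCoprime (Polynomial.X : Polynomial ℂ) (Polynomial.C z - Polynomial.X) := by
    refine ⟨Polynomial.C z⁻¹, Polynomial.C z⁻¹, ?_⟩
    rw [← mul_add, add_sub_cancel, ← Polynomial.C_mul, inv_mul_cancel₀ hz, Polynomial.C_1]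
  obtain ⟨p, q, hpq⟩ := h.pow (m := m) (n := k)
  have hc (r : Polynomial ℂ) : Commute (Polynomial.aeval a r) a := by
    simpa using (Commute.all r Polynomial.X).map (Polynomial.aeval a)
  refine ⟨Polynomial.aeval a p, Polynomial.aeval a q, hc p, hc q, ?_⟩
  simpa [Algebra.algebraMap_eq_smul_one] using congrArg (Polynomial.aeval a) hpq

variable {X : Type*} [NormedAddCommGroup X] [NormedSpace ℂ X]

theorem map_mem_range_pow {A B t : X →L[ℂ] X} (h : SemiconjBy t A B) (k : ℕ) :
    ∀ x ∈ (A ^ k).range, t x ∈ (B ^ k).range := by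
  rintro _ ⟨y, rfl⟩
  exact ⟨t y, (congrArg (fun f : X →L[ℂ] X => f y) (h.pow_right k).eq).symm⟩

theorem map_mem_ker_pow {A B t : X →L[ℂ] X} (h : SemiconjBy t A B) (k : ℕ) :
    ∀ x ∈ (A ^ k).ker, t x ∈ (B ^ k).ker := by
  intro x hx
  have hx : (A ^ k) x = 0 := hx
  have h1 : t ((A ^ k) x) = (B ^ k) (t x) :=
    congrArg (fun f : X →L[ℂ] X => f x) (h.pow_right k).eq
  rw [hx, map_zero] at h1
  exact h1.symm

theorem map_mem_range_sup_ker_pow {A B t : X →L[ℂ] X} (h : SemiconjBy t A B) (d : ℕ) :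
    ∀ x ∈ A.range ⊔ (A ^ d).ker, t x ∈ B.range ⊔ (B ^ d).ker := by
  intro x hx
  obtain ⟨y, hy, w, hw, rfl⟩ := Submodule.mem_sup.1 hx
  rw [map_add]
  refine Submodule.add_mem_sup ?_ (map_mem_ker_pow h d w hw)
  simpa using map_mem_range_pow h 1 y (by simpa using hy)

/-- On `N((z - T) ^ k)` the operator `T ^ n` has an inverse that commutes with `z - T`. -/
theorem exists_commute_pow_apply_eq (T : X →L[ℂ] X) {z : ℂ} (hz : z ≠ 0)
    (n k : ℕ) : ∃ p : X →L[ℂ] X, Commute p (z • (1 : X →L[ℂ] X) - T) ∧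
      ∀ x ∈ ((z • (1 : X →L[ℂ] X) - T) ^ k).ker, (T ^ n) (p x) = x := by
  obtain ⟨p, q, hp, -, hpq⟩ := exists_bezout_pow T hz n k
  refine ⟨p, ((Commute.one_right p).smul_right z).sub_right hp, fun x hx => ?_⟩
  have hx : ((z • (1 : X →L[ℂ] X) - T) ^ k) x = 0 := hx
  rw [(hp.pow_right n).eq] at hpq
  simpa [hx] using congrArg (fun f : X →L[ℂ] X => f x) hpq

/-- `T` and `S` satisfy `S Tⁿ = Tⁿ⁺¹` and `T Sⁿ = Sⁿ⁺¹`. -/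
structure PowIntertwined (T S : X →L[ℂ] X) (n : ℕ) : Prop where
  left : S * T ^ n = T ^ (n + 1)
  right : T * S ^ n = S ^ (n + 1)

namespace PowIntertwined

variable {T S : X →L[ℂ] X} {n : ℕ}

theorem symm (h : PowIntertwined T S n) : PowIntertwined S T n := ⟨h.right, h.left⟩

theorem pow_mul_pow (h : PowIntertwined T S n) (k : ℕ) : T ^ k * S ^ n = S ^ (k + n) := by
  induction k with
  | zero => simp
  | succ k ih =>
    rw [pow_succ, mul_assoc, h.right, pow_succ S n, ← mul_assoc, ih, ← pow_succ]
    congr 1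
    omega

theorem semiconjBy (h : PowIntertwined T S n) (z : ℂ) :
    SemiconjBy (T ^ n) (z • (1 : X →L[ℂ] X) - T) (z • (1 : X →L[ℂ] X) - S) := by
  simp only [SemiconjBy, mul_sub, sub_mul, h.left, ← pow_succ, mul_smul_comm, smul_mul_assoc,
    mul_one, one_mul]

/-- Here `x = T ^ n (p x)`: `p` preserves the kernel and `T ^ n` carries it into that of `(z - S) ^
k`. -/
theorem ker_pow_le (h : PowIntertwined T S n) {z : ℂ} (hz : z ≠ 0) (k : ℕ) :
    ((z • (1 : X →L[ℂ] X) - T) ^ k).ker ≤ ((z • (1 : X →L[ℂ] X) - S) ^ k).ker := by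
  intro x hx
  obtain ⟨p, hp, hpx⟩ := exists_commute_pow_apply_eq T hz n k
  rw [← hpx x hx]
  exact map_mem_ker_pow (h.semiconjBy z) k _ (map_mem_ker_pow hp k x hx)

theorem ker_inf_range_pow_le (h : PowIntertwined T S n) {z : ℂ} (hz : z ≠ 0) (k : ℕ) :
    (z • (1 : X →L[ℂ] X) - T).ker ⊓ ((z • (1 : X →L[ℂ] X) - T) ^ k).range ≤
      (z • (1 : X →L[ℂ] X) - S).ker ⊓ ((z • (1 : X →L[ℂ] X) - S) ^ k).range := by
  rintro x ⟨hx, hxk⟩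
  have hx : x ∈ ((z • (1 : X →L[ℂ] X) - T) ^ 1).ker := by rwa [pow_one]
  have hxS := h.ker_pow_le hz 1 hx
  rw [pow_one] at hxS
  refine ⟨hxS, ?_⟩
  obtain ⟨p, hp, hpx⟩ := exists_commute_pow_apply_eq T hz n 1
  rw [← hpx x hx]
  exact map_mem_range_pow (h.semiconjBy z) k _ (map_mem_range_pow hp k x hxk)

theorem ker_inf_range_pow_eq (h : PowIntertwined T S n) {z : ℂ} (hz : z ≠ 0) (k : ℕ) :
    (z • (1 : X →L[ℂ] X) - T).ker ⊓ ((z • (1 : X →L[ℂ] X) - T) ^ k).range =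
      (z • (1 : X →L[ℂ] X) - S).ker ⊓ ((z • (1 : X →L[ℂ] X) - S) ^ k).range :=
  le_antisymm (h.ker_inf_range_pow_le hz k) (h.symm.ker_inf_range_pow_le hz k)

theorem dis_eq (h : PowIntertwined T S n) {z : ℂ} (hz : z ≠ 0) :
    dis (z • (1 : X →L[ℂ] X) - T) = dis (z • (1 : X →L[ℂ] X) - S) := by
  simp only [dis, stableSet, h.ker_inf_range_pow_eq hz]

/-- There is an operator `t` intertwining `z - T` with `z - S` such that `t ∘ Sⁿ` is the identity
modulo `(z - S) ^ k`. -/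
theorem exists_retract (h : PowIntertwined T S n) {z : ℂ} (hz : z ≠ 0) (k : ℕ) :
    ∃ t q : X →L[ℂ] X, SemiconjBy t (z • (1 : X →L[ℂ] X) - T) (z • (1 : X →L[ℂ] X) - S) ∧
      Commute q (z • (1 : X →L[ℂ] X) - S) ∧
      t * S ^ n + q * (z • (1 : X →L[ℂ] X) - S) ^ k = 1 := by
  -- The exponent `n + n` is that of `T ^ n * S ^ n = S ^ (n + n)`.
  obtain ⟨p, q, hp, hq, hpq⟩ := exists_bezout_pow S hz (n + n) k
  have hc {r : X →L[ℂ] X} (hr : Commute r S) : Commute r (z • (1 : X →L[ℂ] X) - S) :=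
    ((Commute.one_right r).smul_right z).sub_right hr
  refine ⟨p * T ^ n, q, (hc hp).semiconjBy.mul_left (h.semiconjBy z), hc hq, ?_⟩
  rw [mul_assoc, h.pow_mul_pow, hpq]

theorem exists_retract_range_sup_ker (h : PowIntertwined T S n) {z : ℂ} (hz : z ≠ 0) (d : ℕ) :
    ∃ t s : X →L[ℂ] X,
      (∀ x ∈ (z • (1 : X →L[ℂ] X) - T).range ⊔ ((z • (1 : X →L[ℂ] X) - T) ^ d).ker,
        t x ∈ (z • (1 : X →L[ℂ] X) - S).range ⊔ ((z • (1 : X →L[ℂ] X) - S) ^ d).ker) ∧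
      (∀ x ∈ (z • (1 : X →L[ℂ] X) - S).range ⊔ ((z • (1 : X →L[ℂ] X) - S) ^ d).ker,
        s x ∈ (z • (1 : X →L[ℂ] X) - T).range ⊔ ((z • (1 : X →L[ℂ] X) - T) ^ d).ker) ∧
      ∀ x, x - t (s x) ∈
        (z • (1 : X →L[ℂ] X) - S).range ⊔ ((z • (1 : X →L[ℂ] X) - S) ^ d).ker := by
  -- Exponent 1 suffices for every `d`: the error lies in `R(z - S)`, one of the two summands.
  obtain ⟨t, q, ht, hq, hts⟩ := h.exists_retract hz 1
  refine ⟨t, S ^ n, map_mem_range_sup_ker_pow ht d,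
    map_mem_range_sup_ker_pow (h.symm.semiconjBy z) d, fun x => Submodule.mem_sup_left ?_⟩
  rw [pow_one, hq.eq] at hts
  refine ⟨q x, eq_sub_of_add_eq' ?_⟩
  exact congrArg (fun f : X →L[ℂ] X => f x) hts

theorem isLeftBFredholm (h : PowIntertwined T S n) {z : ℂ} (hz : z ≠ 0)
    (hT : IsLeftBFredholm (z • (1 : X →L[ℂ] X) - T)) :
    IsLeftBFredholm (z • (1 : X →L[ℂ] X) - S) := by
  obtain ⟨d, hd, hker, hrange⟩ := hT
  obtain ⟨t, s, ht, hs, hts⟩ := h.exists_retract_range_sup_ker hz d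
  exact ⟨d, h.dis_eq hz ▸ hd, h.ker_inf_range_pow_eq hz d ▸ hker,
    closedComplemented_of_retract ht hs hts hrange⟩

theorem isRightBFredholm (h : PowIntertwined T S n) {z : ℂ} (hz : z ≠ 0)
    (hT : IsRightBFredholm (z • (1 : X →L[ℂ] X) - T)) :
    IsRightBFredholm (z • (1 : X →L[ℂ] X) - S) := by
  obtain ⟨d, hd, hclosed, hrange, hker⟩ := hT
  obtain ⟨t, s, ht, hs, hts⟩ := h.exists_retract_range_sup_ker hz d
  exact ⟨d, h.dis_eq hz ▸ hd, isClosed_of_retract ht hs hts hclosed,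
    finiteDimensional_quotient_of_retract ht hs hts hrange, h.ker_inf_range_pow_eq hz d ▸ hker⟩

theorem isClosed_range_pow (h : PowIntertwined T S n) {z : ℂ} (hz : z ≠ 0) {k : ℕ}
    (hT : IsClosed (((z • (1 : X →L[ℂ] X) - T) ^ k).range : Set X)) :
    IsClosed (((z • (1 : X →L[ℂ] X) - S) ^ k).range : Set X) := by
  obtain ⟨t, q, ht, hq, hts⟩ := h.exists_retract hz k
  refine isClosed_of_retract (s := S ^ n) (map_mem_range_pow ht k)
    (map_mem_range_pow (h.symm.semiconjBy z) k) (fun x => ?_) hT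
  rw [(hq.pow_right k).eq] at hts
  refine ⟨q x, eq_sub_of_add_eq' ?_⟩
  exact congrArg (fun f : X →L[ℂ] X => f x) hts

theorem isBFredholm (h : PowIntertwined T S n) {z : ℂ} (hz : z ≠ 0)
    (hT : IsBFredholm (z • (1 : X →L[ℂ] X) - T)) : IsBFredholm (z • (1 : X →L[ℂ] X) - S) := by
  obtain ⟨k, hclosed, hfred⟩ := hT
  -- Exponent 1, not `k`: the identity is restricted to `R((z - S) ^ k)`, where the error must be a
  -- multiple of `z - S` itself.
  obtain ⟨t, q, ht, hq, hts⟩ := h.exists_retract hz 1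
  rw [pow_one] at hts
  have hs := h.symm.semiconjBy z
  refine ⟨k, h.isClosed_range_pow hz hclosed,
    isFredholm_of_intertwining (t := t.restrict (map_mem_range_pow ht k))
      (s := (S ^ n).restrict (map_mem_range_pow hs k))
      (q := q.restrict (map_mem_range_pow hq k)) ?_ ?_ ?_ ?_ hfred⟩
  · ext x
    exact congrArg (fun f : X →L[ℂ] X => f x) ht.eq
  · ext x
    exact congrArg (fun f : X →L[ℂ] X => f x) hs.eq
  · ext x
    exact congrArg (fun f : X →L[ℂ] X => f x) hq.eq
  · ext x
    exact congrArg (fun f : X →L[ℂ] X => f x) hts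

end PowIntertwined

end BFredholm

theorem mainTheorem9 {X : Type*} [NormedAddCommGroup X] [NormedSpace ℂ X] [CompleteSpace X]
    (T S : X →L[ℂ] X) (n : ℕ) (hST : S * T ^ n = T ^ (n + 1)) (hTS : T * S ^ n = S ^ (n + 1)) :
    BFredholm.leftBFredholmSpectrum T \ {0} = BFredholm.leftBFredholmSpectrum S \ {0} ∧
    BFredholm.rightBFredholmSpectrum T \ {0} = BFredholm.rightBFredholmSpectrum S \ {0} ∧
    BFredholm.bFredholmSpectrum T \ {0} = BFredholm.bFredholmSpectrum S \ {0} := by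
  have h : BFredholm.PowIntertwined T S n := ⟨hST, hTS⟩
  refine ⟨Set.ext fun z => and_congr_left fun hz => not_congr ?_,
    Set.ext fun z => and_congr_left fun hz => not_congr ?_,
    Set.ext fun z => and_congr_left fun hz => not_congr ?_⟩
  · exact ⟨h.isLeftBFredholm hz, h.symm.isLeftBFredholm hz⟩
  · exact ⟨h.isRightBFredholm hz, h.symm.isRightBFredholm hz⟩
  · exact ⟨h.isBFredholm hz, h.symm.isBFredholm hz⟩
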